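/- **Embedding criterion.** Let $|a|<m$, $r_+=m+\sqrt{m^2-a^2}$, $\mathbb S^2\subset\mathbb R^3$ the unit sphere with spherical coordinates $(\theta,\varphi)$, and let $(v,r,\omega)\in\mathbb R\times\mathbb R\times\mathbb S^2$ be ingoing Eddington–Finkelstein coordinates, in which the Kerr metric is $$\mathbf g_{a,m}=-\Big(1-\frac{2mr}{|q|^2}\Big)(dv-a\sin^2\theta\,d\varphi)^2+2(dv-a\sin^2\theta\,d\varphi)(dr-a\sin^2\theta\,d\varphi)+|q|^2(d\theta^2+\sin^2\theta\,d\varphi^2),\qquad |q|^2=r^2+a^2\cos^2\theta .$$ Put $\tau=v-r$. An *$\varepsilon$-perturbation of Kerr* is a smooth Lorentzian metric $g$ on the region $\{\tau\ge 0,\ |r-r_+|<2\delta\}$ with $|(g-\mathbf g_{a,m})(X,Y)|\le\varepsilon\,|X|_0\,|Y|_0$ for all tangent vectors $X,Y$ at a common point, where $|\cdot|_0$ is the norm of $dv^2+dr^2+r^2(d\theta^2+\sin^2\theta\,d\varphi^2)$. Let $\Sigma_{\tau_0}=\{\tau=\tau_0,\ |r-r_+|<2\delta\}$ and let $\Phi_{\Sigma_{\tau_0}}:(r_+-2\delta,r_++2\delta)\times\mathbb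 S^2\to\Sigma_{\tau_0}$, $\Phi_{\Sigma_{\tau_0}}(r,\omega)=(\tau_0+r,r,\omega)$. There are $\delta_0>0$ and $\mathring\delta>0$, depending only on $a,m$, such that for every $0<\delta\le\delta_0$ there is $\varepsilon_0>0$ with the following property. Let $0\le\varepsilon\le\varepsilon_0$, let $g$ be an $\varepsilon$-perturbation of Kerr, let $\tau_0\ge0$, and let $i:\mathbb S^2\to\Sigma_{\tau_0}$ be an immersion (a smooth map with injective tangent map at every point) with $i(\mathbb S^2)\subset\{|r-r_+|\le\delta\}$. Suppose that every $p\in\mathbb S^2$ has an open neighbourhood $\mathcal O_p$ such that $i|_{\mathcal O_p}$ is an embedding and such that there is a frame $(e_1,e_2)$ on $i(\mathcal O_p)$, tangent to $i(\mathcal O_p)$ and orthonormal for the metric induced by $g$, with $|e_b(r)|\le\mathring\delta$ on $i(\mathcal O_p)$ for $b=1,2$. Then $i$ is an embedding (an injective immersion that is a homeomorphism onto its image), and there is a smooth map $R:\mathbb S^2\to[r_+-\delta,r_++\delta]$ such that $$\Phi_{\Sigma_{\tau_0}}\big(\{(R(p),p):p\in\mathbb S^2\}\big)=i(\mathbb S^2).$$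 -/

import Mathlib

open scoped Manifold ContDiff Topology

namespace KerrSlab

noncomputable section

/-- The unit sphere in `ℝ³`, with the smooth structure of Mathlib. -/
abbrev S2 : Type := Metric.sphere (0 : EuclideanSpace ℝ (Fin 3)) 1

/-- The ambient manifold `ℝ × ℝ × 𝕊²` of the ingoing coordinates `(v, r, ω)`, where `ω ∈ 𝕊²` has
spherical coordinates `(θ, φ)`. -/
abbrev M4 : Type := ℝ × ℝ × S2

/-- The model with corners of `M4`. -/
abbrev I4 := 𝓘(ℝ, ℝ).prod (𝓘(ℝ, ℝ).prod (𝓡 2))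

/-- The model vector space of `M4`. -/
abbrev E4 : Type := ℝ × ℝ × EuclideanSpace ℝ (Fin 2)

/-- The coordinate function `v`. -/
def vCoord (x : M4) : ℝ := x.1

/-- The coordinate function `r`. -/
def rCoord (x : M4) : ℝ := x.2.1

/-- The spherical coordinate, as a unit vector
`ω = (sin θ cos φ, sin θ sin φ, cos θ) = (x¹, x², cos θ)` of `ℝ³`. -/
def omegaCoord (x : M4) : EuclideanSpace ℝ (Fin 3) := (x.2.2 : EuclideanSpace ℝ (Fin 3))

/-- The differential `dv`. -/
def dv (x : M4) (X : TangentSpace I4 x) : ℝ := mfderiv I4 𝓘(ℝ, ℝ) vCoord x X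

/-- The differential `dr`; thus `dr x X = X(r)`. -/
def dr (x : M4) (X : TangentSpace I4 x) : ℝ := mfderiv I4 𝓘(ℝ, ℝ) rCoord x X

/-- The differential of `ω`; the round metric `dθ² + sin² θ dφ²` is `|dω|²`. -/
def dOmega (x : M4) (X : TangentSpace I4 x) : EuclideanSpace ℝ (Fin 3) :=
  mfderiv I4 𝓘(ℝ, EuclideanSpace ℝ (Fin 3)) omegaCoord x X

/-- The one-form `sin² θ dφ = x¹ dx² - x² dx¹`. -/
def sinSqDphi (x : M4) (X : TangentSpace I4 x) : ℝ :=
  omegaCoord x 0 * dOmega x X 1 - omegaCoord x 1 * dOmega x X 0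

/-- `|q|² = r² + a² cos² θ`. -/
def qSq (a : ℝ) (x : M4) : ℝ := rCoord x ^ 2 + a ^ 2 * omegaCoord x 2 ^ 2

/-- The Kerr metric in ingoing Eddington-Finkelstein coordinates, as a symmetric bilinear form:
`-(1 - 2mr/|q|²) (dv - a sin² θ dφ)² + 2 (dv - a sin² θ dφ) (dr - a sin² θ dφ)`
`+ |q|² (dθ² + sin² θ dφ²)`. -/
def kerr (m a : ℝ) (x : M4) (X Y : TangentSpace I4 x) : ℝ :=
  -(1 - 2 * m * rCoord x / qSq a x)
      * ((dv x X - a * sinSqDphi x X) * (dv x Y - a * sinSqDphi x Y))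
    + ((dv x X - a * sinSqDphi x X) * (dr x Y - a * sinSqDphi x Y)
      + (dv x Y - a * sinSqDphi x Y) * (dr x X - a * sinSqDphi x X))
    + qSq a x * inner ℝ (dOmega x X) (dOmega x Y)

/-- The length of a tangent vector with respect to the reference Riemannian metric
`dv² + dr² + r² (dθ² + sin² θ dφ²)`. It measures the size of the components of a tensor in the
coframes `(dv, dr, r dθ, r sin θ dφ)` (away from the poles) and `(dv, dr, r dx¹, r dx²)` (near
the poles), up to a numerical factor. -/
def refLength (x : M4) (X : TangentSpace I4 x) : ℝ :=
  Real.sqrt (dv x X ^ 2 + dr x X ^ 2 + rCoord x ^ 2 * ‖dOmega x X‖ ^ 2)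

/-- `r₊ = m + √(m² - a²)`. -/
def rPlus (m a : ℝ) : ℝ := m + Real.sqrt (m ^ 2 - a ^ 2)

/-- The time function `τ = v - r`. -/
def tau (x : M4) : ℝ := vCoord x - rCoord x

/-- The spacetime region under consideration: the part of `{|r - r₊| < 2δ}` in the future
`{τ ≥ 0}` of the initial hypersurface. -/
def region (m a δ : ℝ) : Set M4 := {x | 0 ≤ tau x ∧ |rCoord x - rPlus m a| < 2 * δ}

/-- The closed neighbourhood `ℛ_δ = {|r - r₊| ≤ δ}`. -/
def nearHorizon (m a δ : ℝ) : Set M4 := {x | |rCoord x - rPlus m a| ≤ δ}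

/-- The hypersurface `Σ_τ`, the level set of the time function in `{|r - r₊| < 2δ}`. -/
def slice (m a δ τ : ℝ) : Set M4 := {x | tau x = τ ∧ |rCoord x - rPlus m a| < 2 * δ}

/-- The map `Φ_{Σ_τ} : (r₊ - 2δ, r₊ + 2δ) × 𝕊² → Σ_τ` given by the coordinates `(r, ω)`
of `Σ_τ`. -/
def sliceMap (τ : ℝ) (y : ℝ × S2) : M4 := (τ + y.1, y.1, y.2)

/-- `Φ_{Σ_τ}` is a bijection onto `Σ_τ`. -/
theorem sliceMap_bijOn (m a δ τ : ℝ) :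
    Set.BijOn (sliceMap τ)
      (Set.Ioo (rPlus m a - 2 * δ) (rPlus m a + 2 * δ) ×ˢ Set.univ) (slice m a δ τ) := by
  refine ⟨?_, ?_, ?_⟩
  · rintro ⟨r, p⟩ ⟨⟨h1, h2⟩, -⟩
    refine ⟨by simp [tau, vCoord, rCoord, sliceMap], ?_⟩
    rw [abs_lt]
    simp only [rCoord, sliceMap] at *
    constructor <;> linarith
  · rintro ⟨r, p⟩ - ⟨r', p'⟩ - h
    simp only [sliceMap, Prod.mk.injEq] at h
    exact Prod.ext h.2.1 h.2.2
  · rintro ⟨v, r, p⟩ ⟨h1, h2⟩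
    rw [abs_lt] at h2
    simp only [tau, vCoord, rCoord] at *
    refine ⟨(r, p), ⟨⟨by simp only; linarith, by simp only; linarith⟩, trivial⟩, ?_⟩
    simp only [sliceMap, Prod.mk.injEq, and_true]
    linarith

/-- A bilinear form on a tangent space of `M4` is Lorentzian, of signature `(-,+,+,+)`: there is
a timelike vector, and the form is positive definite on its orthogonal complement. -/
def IsLorentzian {x : M4} (g : TangentSpace I4 x →L[ℝ] TangentSpace I4 x →L[ℝ] ℝ) : Prop :=
  (∀ X Y, g X Y = g Y X) ∧
    ∃ T, g T T < 0 ∧ ∀ X, g T X = 0 → X ≠ 0 → 0 < g X X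

/-- Smoothness on a set `s` of a field `g` of continuous bilinear forms on the fibres of a vector
bundle `E` with model fibre `F`: it is a smooth section of the bundle `Hom(E, Hom(E, ℝ))`. -/
def IsSmoothBilinOn {EB : Type*} [NormedAddCommGroup EB] [NormedSpace ℝ EB]
    {HB : Type*} [TopologicalSpace HB] (IB : ModelWithCorners ℝ EB HB)
    {B : Type*} [TopologicalSpace B] [ChartedSpace HB B]
    (F : Type*) [NormedAddCommGroup F] [NormedSpace ℝ F]
    (E : B → Type*) [TopologicalSpace (Bundle.TotalSpace F E)]
    [∀ b, TopologicalSpace (E b)] [∀ b, AddCommGroup (E b)] [∀ b, Module ℝ (E b)]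
    [∀ b, IsTopologicalAddGroup (E b)] [∀ b, ContinuousConstSMul ℝ (E b)]
    [FiberBundle F E] [VectorBundle ℝ F E]
    (g : (b : B) → E b →L[ℝ] E b →L[ℝ] ℝ) (s : Set B) : Prop :=
  ContMDiffOn IB (IB.prod 𝓘(ℝ, F →L[ℝ] F →L[ℝ] ℝ)) ∞
    (fun b => Bundle.TotalSpace.mk' (F →L[ℝ] F →L[ℝ] ℝ) b (g b)) s

/-- A smooth Lorentzian metric on the spacetime region `{τ ≥ 0, |r - r₊| < 2δ}` that is an
`ε`-perturbation of the Kerr metric of parameters `(a, m)`. (The values of `g` outside the region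
are irrelevant.) -/
structure PerturbedKerr (m a δ ε : ℝ) where
  /-- The metric. -/
  g : (x : M4) → TangentSpace I4 x →L[ℝ] TangentSpace I4 x →L[ℝ] ℝ
  lorentzian : ∀ x ∈ region m a δ, IsLorentzian (g x)
  smooth : IsSmoothBilinOn I4 E4 (fun x : M4 => TangentSpace I4 x) g (region m a δ)
  close : ∀ x ∈ region m a δ, ∀ X Y : TangentSpace I4 x,
    |g x X Y - kerr m a x X Y| ≤ ε * refLength x X * refLength x Y

/-- An immersion of the sphere: a smooth map whose tangent map is injective at every point. For a
map with values in the hypersurface `Σ_τ` this is the same as being an immersion into `Σ_τ`. -/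
def IsImmersionMap (f : S2 → M4) : Prop :=
  ContMDiff (𝓡 2) I4 ∞ f ∧ ∀ p, Function.Injective (mfderiv (𝓡 2) I4 f p)

/-- An embedding of the sphere: an injective immersion that is a homeomorphism onto its image
with the subspace topology. -/
def IsEmbeddingMap (f : S2 → M4) : Prop :=
  IsImmersionMap f ∧ Topology.IsEmbedding f

/-- `e = (e₁, e₂)` is a frame on the surface `i(O)`, tangent to it and orthonormal for the metric
induced by `g`. (No regularity of the frame is asked for.) -/
def IsTangentOrthonormalFrame
    (g : (x : M4) → TangentSpace I4 x →L[ℝ] TangentSpace I4 x →L[ℝ] ℝ)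
    (i : S2 → M4) (O : Set S2) (e : Fin 2 → (x : M4) → TangentSpace I4 x) : Prop :=
  ∀ p ∈ O, (∀ b, e b (i p) ∈ Set.range (mfderiv (𝓡 2) I4 i p)) ∧
    ∀ b c, g (i p) (e b (i p)) (e c (i p)) = if b = c then 1 else 0

end

end KerrSlab

open KerrSlab

/-! Compose `i` with the projection of the slice to the sphere, `f = ω ∘ i`. A vector `X` tangent to
the slice and killed by `dω` has Kerr square `(1 + 2mr/|q|²) dr(X)² ≤ 5 dr(X)²`, hence `g(X, X) ≤ 7
dr(X)²` when `ε ≤ 1`. If `X` is also tangent to the surface, expanding it in the frame and using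
Cauchy–Schwarz with `|e_b(r)| ≤ 1/4` gives `dr(X)² ≤ g(X, X) / 8`. So `X = 0`
(`eq_zero_of_vertical`), and `f` is a local diffeomorphism.

A local homeomorphism of the compact sphere to itself is a covering, and simple connectivity makes
it bijective (`IsLocalHomeomorph.bijective_sphere`). Thus `i` is injective, and the surface is the
graph of `R = r ∘ i ∘ f⁻¹`, smooth by the inverse function theorem. -/

/-! ### Inverse function theorem on manifolds. -/

section InverseFunction

variable {E F : Type*} [NormedAddCommGroup E] [NormedSpace ℝ E] [CompleteSpace E]
  [NormedAddCommGroup F] [NormedSpace ℝ F]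
  {M N : Type*} [TopologicalSpace M] [ChartedSpace E M] [TopologicalSpace N] [ChartedSpace F N]

/-- Inverse function theorem for maps between manifolds without boundary. -/
theorem ContMDiffAt.exists_openPartialHomeomorph {n : ℕ∞ω} [IsManifold 𝓘(ℝ, E) n M]
    [IsManifold 𝓘(ℝ, F) n N] {f : M → N} {x : M} (hn : n ≠ 0)
    (hf : ContMDiffAt 𝓘(ℝ, E) 𝓘(ℝ, F) n f x) (f' : E ≃L[ℝ] F)
    (hf' : ∀ u : E, mfderiv 𝓘(ℝ, E) 𝓘(ℝ, F) f x u = f' u) :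
    ∃ Φ : OpenPartialHomeomorph M N, x ∈ Φ.source ∧ Set.EqOn f Φ Φ.source ∧
      ContMDiffAt 𝓘(ℝ, F) 𝓘(ℝ, E) n Φ.symm (f x) := by
  set φ := chartAt E x with hφ
  set ψ := chartAt F (f x) with hψ
  set g : E → F := writtenInExtChartAt 𝓘(ℝ, E) 𝓘(ℝ, F) x f with hg
  have hgφ : ∀ y, g y = ψ (f (φ.symm y)) := fun y => by
    simp [hg, writtenInExtChartAt, hφ, hψ, mfld_simps]
  have hgx : g (φ x) = ψ (f x) := by
    rw [hgφ, φ.left_inv (mem_chart_source E x)]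
  have hsmooth : ContDiffAt ℝ n g (φ x) := by
    have h := (contMDiffAt_iff.1 hf).2
    simpa [hg, writtenInExtChartAt, hφ, mfld_simps, contDiffWithinAt_univ] using h
  have hderiv : HasFDerivAt g (f' : E →L[ℝ] F) (φ x) := by
    have h := (hf.mdifferentiableAt hn).hasMFDerivAt.2
    have h' : mfderiv 𝓘(ℝ, E) 𝓘(ℝ, F) f x = (f' : E →L[ℝ] F) := ContinuousLinearMap.ext hf'
    rw [h'] at h
    have h₁ : HasFDerivWithinAt g (f' : E →L[ℝ] F) (Set.range 𝓘(ℝ, E)) (φ x) := h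
    rwa [modelWithCornersSelf_coe, Set.range_id, hasFDerivWithinAt_univ] at h₁
  let e := hsmooth.toOpenPartialHomeomorph g hderiv hn
  have heg : ∀ y, e y = g y := fun _ => rfl
  have hex : φ x ∈ e.source := hsmooth.mem_toOpenPartialHomeomorph_source hderiv hn
  have hxf : f x ∈ ψ.source := mem_chart_source F (f x)
  have hnhds : f ⁻¹' ψ.source ∈ 𝓝 x :=
    hf.continuousAt.preimage_mem_nhds (ψ.open_source.mem_nhds hxf)
  -- The chart expression gives back `f` only where `f` stays in the chart `ψ`, hence the
  -- restriction.
  refine ⟨((φ.trans e).trans ψ.symm).restr (f ⁻¹' ψ.source), ?_, ?_, ?_⟩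
  · rw [OpenPartialHomeomorph.restr_source]
    refine ⟨?_, mem_interior_iff_mem_nhds.2 hnhds⟩
    simp only [OpenPartialHomeomorph.trans_source, OpenPartialHomeomorph.coe_trans,
      Set.mem_inter_iff, Set.mem_preimage, Function.comp_apply, heg, hgx,
      OpenPartialHomeomorph.symm_source]
    exact ⟨⟨mem_chart_source E x, hex⟩, ψ.map_source hxf⟩
  · intro y hy
    rw [OpenPartialHomeomorph.restr_source] at hy
    obtain ⟨hy1, hy2⟩ := hy
    have hyφ : y ∈ φ.source := by
      simp only [OpenPartialHomeomorph.trans_source] at hy1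
      exact hy1.1.1
    have hyψ : f y ∈ ψ.source := interior_subset (s := f ⁻¹' ψ.source) hy2
    simp only [OpenPartialHomeomorph.restr_apply, OpenPartialHomeomorph.coe_trans,
      Function.comp_apply, heg, hgφ, φ.left_inv hyφ, ψ.left_inv hyψ]
  · have h1 : ContMDiffAt 𝓘(ℝ, F) 𝓘(ℝ, F) n ψ (f x) :=
      contMDiffOn_chart.contMDiffAt (ψ.open_source.mem_nhds hxf)
    have h2 : ContMDiffAt 𝓘(ℝ, F) 𝓘(ℝ, E) n e.symm (ψ (f x)) := by
      rw [← hgx]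
      exact (hsmooth.to_localInverse hderiv hn).contMDiffAt
    have h3 : ContMDiffAt 𝓘(ℝ, E) 𝓘(ℝ, E) n φ.symm (e.symm (ψ (f x))) := by
      have : e.symm (ψ (f x)) = φ x := by rw [← hgx]; exact e.left_inv hex
      rw [this]
      exact contMDiffOn_chart_symm.contMDiffAt
        (φ.open_target.mem_nhds (φ.map_source (mem_chart_source E x)))
    exact ContMDiffAt.comp (g := φ.symm) (f x) h3 (h2.comp (f x) h1)

/-- A smooth map whose tangent maps are all invertible is a local homeomorphism. -/
theorem ContMDiff.isLocalHomeomorph {n : ℕ∞ω} [IsManifold 𝓘(ℝ, E) n M]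
    [IsManifold 𝓘(ℝ, F) n N] {f : M → N} (hn : n ≠ 0) (hf : ContMDiff 𝓘(ℝ, E) 𝓘(ℝ, F) n f)
    (hf' : ∀ x, ∃ f' : E ≃L[ℝ] F, ∀ u : E, mfderiv 𝓘(ℝ, E) 𝓘(ℝ, F) f x u = f' u) :
    IsLocalHomeomorph f := by
  refine IsLocalHomeomorph.mk f fun x => ?_
  obtain ⟨f', h'⟩ := hf' x
  obtain ⟨Φ, hx, hΦ, -⟩ := (hf x).exists_openPartialHomeomorph hn f' h'
  exact ⟨Φ, hx, hΦ⟩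

/-- The inverse of a smooth bijection whose tangent maps are all invertible is smooth. -/
theorem ContMDiff.contMDiff_inverse {n : ℕ∞ω} [IsManifold 𝓘(ℝ, E) n M]
    [IsManifold 𝓘(ℝ, F) n N] {f : M → N} {f₁ : N → M} (hn : n ≠ 0)
    (hf : ContMDiff 𝓘(ℝ, E) 𝓘(ℝ, F) n f)
    (hf' : ∀ x, ∃ f' : E ≃L[ℝ] F, ∀ u : E, mfderiv 𝓘(ℝ, E) 𝓘(ℝ, F) f x u = f' u)
    (hleft : Function.LeftInverse f₁ f) (hright : Function.RightInverse f₁ f) :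
    ContMDiff 𝓘(ℝ, F) 𝓘(ℝ, E) n f₁ := by
  intro y
  obtain ⟨x, rfl⟩ := hright.surjective y
  obtain ⟨f', h'⟩ := hf' x
  obtain ⟨Φ, hx, hΦ, hs⟩ := (hf x).exists_openPartialHomeomorph hn f' h'
  -- The global inverse coincides near `f x` with the smooth local one.
  refine hs.congr_of_eventuallyEq ?_
  have hmem : f x ∈ Φ.target := by rw [hΦ hx]; exact Φ.map_source hx
  filter_upwards [Φ.open_target.mem_nhds hmem] with z hz
  have h1 : f (Φ.symm z) = z := by rw [hΦ (Φ.map_target hz), Φ.right_inv hz]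
  rw [← hleft (Φ.symm z), h1]

end InverseFunction

/-! ### Self-coverings of spheres. -/

section SphereCovering

open Metric Module

variable {E : Type*} [NormedAddCommGroup E] [InnerProductSpace ℝ E]

/-- The complement of a countable set in a sphere of dimension at least two is preconnected. -/
theorem Set.Countable.isPreconnected_compl_sphere {n : ℕ} [Fact (finrank ℝ E = n + 1)]
    (hn : 1 < n) {s : Set (sphere (0 : E) 1)} (hs : s.Countable) : IsPreconnected sᶜ := by
  have : FiniteDimensional ℝ E := .of_fact_finrank_eq_succ n
  rcases s.eq_empty_or_nonempty with rfl | ⟨p, hp⟩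
  · rw [Set.compl_empty]
    have hrank : 1 < Module.rank ℝ E := by
      rw [← finrank_eq_rank, Fact.out (p := finrank ℝ E = n + 1)]
      exact_mod_cast by omega
    have := isPreconnected_iff_preconnectedSpace.1 (isPreconnected_sphere hrank (0 : E) 1)
    exact isPreconnected_univ
  -- Projecting from a point of `s` itself puts all of `sᶜ` in the chart, as the complement of a
  -- countable set in a vector space of dimension at least two.
  · have hv : ‖(p : E)‖ = 1 := norm_eq_of_mem_sphere p
    let σ := stereographic hv
    have hσ : Topology.IsOpenEmbedding σ.symm := isOpenEmbedding_stereographic_symm hv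
    have hrange : Set.range σ.symm = {p}ᶜ := range_stereographic_symm hv p.2
    have hrank : 1 < Module.rank ℝ ((Submodule.span ℝ {(p : E)})ᗮ : Submodule ℝ E) := by
      rw [← finrank_eq_rank, Submodule.finrank_orthogonal_span_singleton
        (ne_zero_of_mem_unit_sphere p) (n := n)]
      exact_mod_cast hn
    have hc := ((hs.preimage hσ.injective).isPathConnected_compl_of_one_lt_rank hrank).isConnected
    have himage : σ.symm '' (σ.symm ⁻¹' s)ᶜ = sᶜ := by
      rw [← Set.preimage_compl, Set.image_preimage_eq_inter_range, hrange]
      refine Set.inter_eq_left.2 ?_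
      exact Set.compl_subset_compl.2 (Set.singleton_subset_iff.2 hp)
    rw [← himage]
    exact hc.isPreconnected.image _ hσ.continuous.continuousOn

/-- A local homeomorphism of a sphere of dimension at least two to itself is injective. -/
theorem IsLocalHomeomorph.injective_sphere {n : ℕ} [Fact (finrank ℝ E = n + 1)] (hn : 1 < n)
    {f : sphere (0 : E) 1 → sphere (0 : E) 1} (hf : IsLocalHomeomorph f) :
    Function.Injective f := by
  have : FiniteDimensional ℝ E := .of_fact_finrank_eq_succ n
  have hcov : IsCoveringMap f := isLocalHomeomorph_iff_isCoveringMap.1 hf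
  intro x y hxy
  let p : sphere (0 : E) 1 := -f x
  have hp : f x ≠ p := ne_neg_of_mem_unit_sphere ℝ (f x)
  have hv : ‖(p : E)‖ = 1 := norm_eq_of_mem_sphere p
  let σ := stereographic hv
  have hleft : ∀ z, z ≠ p → σ.symm (σ z) = z := fun z hz => σ.left_inv hz
  let j : C((Submodule.span ℝ {(p : E)})ᗮ, sphere (0 : E) 1) :=
    ⟨σ.symm, (isOpenEmbedding_stereographic_symm hv).continuous⟩
  -- The chart domain is a vector space, so inverse stereographic projection lifts through `f`: `Γ ∘
  -- σ` is a section of `f` off `p`, taking `f x` to `x`.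
  obtain ⟨Γ, ⟨hΓx, hΓ⟩, -⟩ := hcov.existsUnique_continuousMap_lifts j (σ (f x)) x
    (hleft _ hp).symm
  have hfib : (f ⁻¹' {p}).Countable :=
    (HereditarilyLindelofSpace.isLindelof _).countable_of_isDiscrete
      ⟨(hcov p).discreteTopology_fiber⟩
  have hconn := hfib.isPreconnected_compl_sphere hn
  have hΓf : ∀ w, f (Γ w) = σ.symm w := fun w => congrFun hΓ w
  have hcont : ContinuousOn (fun z => Γ (σ (f z))) (f ⁻¹' {p})ᶜ :=
    Γ.continuous.comp_continuousOn
      (σ.continuousOn.comp hf.continuous.continuousOn fun z hz => hz)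
  -- Off the fibre over `p`, both `Γ ∘ σ ∘ f` and the identity lift `f`, and they agree at `x`.
  -- Hence every point there is determined by its image.
  have key := hcov.eqOn_of_comp_eqOn hconn hcont continuousOn_id
    (fun z hz => by
      simp only [Function.comp_apply, hΓf, id]
      exact hleft _ hz)
    (a := x) hp hΓx
  have hy : y ∈ (f ⁻¹' {p})ᶜ := fun h => hp (hxy.trans h)
  have hyx := key hy
  simp only [id] at hyx
  rw [← hyx, ← hxy, hΓx]

/-- A local homeomorphism of a sphere of dimension at least two to itself is bijective. -/
theorem IsLocalHomeomorph.bijective_sphere {n : ℕ} [Fact (finrank ℝ E = n + 1)] (hn : 1 < n)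
    {f : sphere (0 : E) 1 → sphere (0 : E) 1} (hf : IsLocalHomeomorph f) :
    Function.Bijective f := by
  refine ⟨hf.injective_sphere hn, ?_⟩
  have : FiniteDimensional ℝ E := .of_fact_finrank_eq_succ n
  have : Nontrivial E := nontrivial_of_finrank_pos (R := ℝ) (by
    rw [Fact.out (p := finrank ℝ E = n + 1)]; omega)
  have hpre : PreconnectedSpace (sphere (0 : E) 1) := ⟨by
    simpa using (Set.countable_empty (α := sphere (0 : E) 1)).isPreconnected_compl_sphere hn⟩
  have hne : Nonempty (sphere (0 : E) 1) := (NormedSpace.sphere_nonempty.2 zero_le_one).to_subtype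
  have hclopen : IsClopen (Set.range f) :=
    ⟨(isCompact_range hf.continuous).isClosed, hf.isOpenMap.isOpen_range⟩
  exact Set.range_eq_univ.1 (hclopen.eq_univ (Set.range_nonempty f))

end SphereCovering

/-! ### Transversality to the vertical direction. -/

namespace KerrSlab

theorem dv_apply (x : M4) (X : TangentSpace I4 x) : dv x X = X.1 := by
  simp only [dv]
  have : mfderiv I4 𝓘(ℝ, ℝ) vCoord x = ContinuousLinearMap.fst ℝ ℝ (ℝ × EuclideanSpace ℝ (Fin 2)) :=
    mfderiv_fst
  rw [this]
  rfl

theorem hasMFDerivAt_snd_snd (x : M4) :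
    HasMFDerivAt I4 (𝓡 2) (fun y : M4 => y.2.2) x
      ((ContinuousLinearMap.snd ℝ ℝ (EuclideanSpace ℝ (Fin 2))).comp
        (ContinuousLinearMap.snd ℝ ℝ (ℝ × EuclideanSpace ℝ (Fin 2)))) :=
  HasMFDerivAt.comp (I' := 𝓘(ℝ, ℝ).prod (𝓡 2)) x (hasMFDerivAt_snd (x := x.2))
    (hasMFDerivAt_snd (x := x))

theorem dr_apply (x : M4) (X : TangentSpace I4 x) : dr x X = X.2.1 := by
  have h : HasMFDerivAt I4 𝓘(ℝ, ℝ) rCoord x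
      ((ContinuousLinearMap.fst ℝ ℝ (EuclideanSpace ℝ (Fin 2))).comp
        (ContinuousLinearMap.snd ℝ ℝ (ℝ × EuclideanSpace ℝ (Fin 2)))) :=
    HasMFDerivAt.comp (I' := 𝓘(ℝ, ℝ).prod (𝓡 2)) x (hasMFDerivAt_fst (x := x.2))
      (hasMFDerivAt_snd (x := x))
  simp only [dr]
  rw [h.mfderiv]
  rfl

theorem dOmega_eq_zero (x : M4) (X : TangentSpace I4 x) (hX : X.2.2 = 0) : dOmega x X = 0 := by
  have : Fact (Module.finrank ℝ (EuclideanSpace ℝ (Fin 3)) = 2 + 1) := ⟨by simp⟩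
  have hs : MDifferentiableAt (𝓡 2) 𝓘(ℝ, EuclideanSpace ℝ (Fin 3))
      ((↑) : S2 → EuclideanSpace ℝ (Fin 3)) x.2.2 :=
    (contMDiff_coe_sphere (m := 1) x.2.2).mdifferentiableAt one_ne_zero
  have h := HasMFDerivAt.comp x hs.hasMFDerivAt (hasMFDerivAt_snd_snd x)
  simp only [dOmega]
  have h2 : mfderiv I4 𝓘(ℝ, EuclideanSpace ℝ (Fin 3)) omegaCoord x = _ := h.mfderiv
  rw [h2]
  refine (congrArg (mfderiv (𝓡 2) 𝓘(ℝ, EuclideanSpace ℝ (Fin 3))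
    ((↑) : S2 → EuclideanSpace ℝ (Fin 3)) x.2.2) hX).trans ?_
  exact map_zero _

/-- The Kerr metric on a tangent vector of a slice `τ = const` that is vertical for the
projection to the sphere. -/
theorem kerr_self_of_vertical (m a : ℝ) (x : M4) (X : TangentSpace I4 x) (hv : dv x X = dr x X)
    (hω : dOmega x X = 0) :
    kerr m a x X X = (1 + 2 * m * rCoord x / qSq a x) * dr x X ^ 2 := by
  have h0 : sinSqDphi x X = 0 := by simp [sinSqDphi, hω]
  rw [kerr, h0, hv, hω]
  simp only [inner_zero_left, mul_zero, sub_zero, add_zero]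
  ring

theorem refLength_mul_self_of_vertical (x : M4) (X : TangentSpace I4 x) (hv : dv x X = dr x X)
    (hω : dOmega x X = 0) : refLength x X * refLength x X = 2 * dr x X ^ 2 := by
  rw [refLength, Real.mul_self_sqrt (by positivity), hv, hω]
  simp only [norm_zero]
  ring

/-- Since `|q|² ≥ r²`, the quotient is at most `2m/r`. -/
theorem kerr_coefficient_le (m a : ℝ) (hm : 0 < m) (x : M4) (hr : m / 2 ≤ rCoord x) :
    2 * m * rCoord x / qSq a x ≤ 4 := by
  have hr0 : 0 < rCoord x := by linarith
  have hq : 0 < qSq a x := by unfold qSq; positivity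
  rw [div_le_iff₀ hq]
  have : m * rCoord x ≤ 2 * rCoord x * rCoord x := by gcongr; linarith
  unfold qSq
  nlinarith [mul_nonneg (sq_nonneg a) (sq_nonneg (omegaCoord x 2))]

/-- A bilinear form with an orthonormal frame in the image of `D` is there the sum of the squares of
the components in this frame. -/
theorem exists_components_of_orthonormal {V W : Type*} [AddCommGroup V] [Module ℝ V]
    [AddCommGroup W] [Module ℝ W] (hV : Module.finrank ℝ V = 2) (D : V →ₗ[ℝ] W)
    (B : W →ₗ[ℝ] W →ₗ[ℝ] ℝ) (e : Fin 2 → W) (he : ∀ b, e b ∈ Set.range D)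
    (hB : ∀ b c, B (e b) (e c) = if b = c then 1 else 0) (u : V) :
    ∃ c : Fin 2 → ℝ, D u = c 0 • e 0 + c 1 • e 1 ∧ B (D u) (D u) = c 0 ^ 2 + c 1 ^ 2 := by
  choose w hw using he
  have hlin : LinearIndependent ℝ w := by
    rw [Fintype.linearIndependent_iff]
    intro c hc k
    -- Pairing with `e k` recovers the coefficients, so the preimages `w` are independent and form a
    -- basis of the plane `V`.
    have h : B (D (∑ j, c j • w j)) (e k) = c k := by
      fin_cases k <;> simp [hw, hB]
    rw [← h, hc]
    simp
  let b := basisOfLinearIndependentOfCardEqFinrank hlin (by simp [hV])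
  have hb : ∀ k, b k = w k := fun k => by simp [b]
  have hu : D u = b.repr u 0 • e 0 + b.repr u 1 • e 1 := by
    conv_lhs => rw [← b.sum_repr u]
    simp [Fin.sum_univ_two, hb, hw]
  refine ⟨b.repr u, hu, ?_⟩
  rw [hu]
  simp [hB]
  ring

/-- Differentiate `v - r = τ` along `i`. -/
theorem dv_eq_dr_of_slice {i : S2 → M4} {τ : ℝ} (hτ : ∀ q, tau (i q) = τ) {p : S2}
    (hi : MDifferentiableAt (𝓡 2) I4 i p) (u : EuclideanSpace ℝ (Fin 2)) :
    dv (i p) (mfderiv (𝓡 2) I4 i p u) = dr (i p) (mfderiv (𝓡 2) I4 i p u) := by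
  have hv : MDifferentiableAt I4 𝓘(ℝ, ℝ) vCoord (i p) := mdifferentiableAt_fst
  have hr : MDifferentiableAt I4 𝓘(ℝ, ℝ) rCoord (i p) :=
    MDifferentiableAt.comp (I' := 𝓘(ℝ, ℝ).prod (𝓡 2)) (i p) (mdifferentiableAt_fst (x := (i p).2))
      (mdifferentiableAt_snd (x := i p))
  have h := (hv.hasMFDerivAt.comp p hi.hasMFDerivAt).sub (hr.hasMFDerivAt.comp p hi.hasMFDerivAt)
  have hc : (vCoord ∘ i - rCoord ∘ i : S2 → ℝ) = fun _ => τ := funext hτ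
  rw [hc] at h
  have h0 := hasMFDerivAt_unique h (hasMFDerivAt_const τ p)
  exact sub_eq_zero.1 (DFunLike.congr_fun h0 u)

/-- The tangent planes of a surface in a slice are transversal to the vertical direction if they
carry orthonormal frames with small `e_b(r)`. -/
theorem eq_zero_of_vertical {m a δ ε τ : ℝ} (ha : |a| < m) (hδ : δ ≤ m / 4) (hε : ε ≤ 1)
    (M : PerturbedKerr m a δ ε) (hτ : 0 ≤ τ) {i : S2 → M4} (hi : IsImmersionMap i)
    (hslice : ∀ p, i p ∈ slice m a δ τ ∩ nearHorizon m a δ) {p : S2}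
    {e : Fin 2 → TangentSpace I4 (i p)}
    (he : ∀ b, e b ∈ Set.range (mfderiv (𝓡 2) I4 i p))
    (hon : ∀ b c, M.g (i p) (e b) (e c) = if b = c then 1 else 0)
    (hdr : ∀ b, |dr (i p) (e b)| ≤ 1 / 4) (u : EuclideanSpace ℝ (Fin 2))
    (hu : (mfderiv (𝓡 2) I4 i p u : E4).2.2 = 0) : u = 0 := by
  have hm : 0 < m := (abs_nonneg a).trans_lt ha
  set X : TangentSpace I4 (i p) := mfderiv (𝓡 2) I4 i p u with hX
  have hv : dv (i p) X = dr (i p) X :=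
    dv_eq_dr_of_slice (fun q => (hslice q).1.1) (hi.1.mdifferentiableAt (by simp)) u
  have hω : dOmega (i p) X = 0 := dOmega_eq_zero _ _ hu
  have hregion : i p ∈ region m a δ := ⟨(hslice p).1.1.symm ▸ hτ, (hslice p).1.2⟩
  have hr : m / 2 ≤ rCoord (i p) := by
    have h1 : |rCoord (i p) - rPlus m a| ≤ δ := (hslice p).2
    have h2 : m ≤ rPlus m a := le_add_of_nonneg_right (Real.sqrt_nonneg _)
    have h3 := (abs_le.1 h1).1
    linarith
  have hclose := (abs_le.1 (M.close _ hregion X X)).2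
  rw [kerr_self_of_vertical m a _ X hv hω, mul_assoc ε,
    refLength_mul_self_of_vertical _ X hv hω] at hclose
  have hcoef := kerr_coefficient_le m a hm (i p) hr
  obtain ⟨c, hc, hg⟩ := exists_components_of_orthonormal (V := TangentSpace (𝓡 2) p)
    (finrank_euclideanSpace_fin (𝕜 := ℝ) (n := 2)) (mfderiv (𝓡 2) I4 i p).toLinearMap
    ((ContinuousLinearMap.coeLM ℝ).comp (M.g (i p)).toLinearMap) e he hon u
  have hs : dr (i p) X = c 0 * dr (i p) (e 0) + c 1 * dr (i p) (e 1) := by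
    have h : X = c 0 • e 0 + c 1 • e 1 := hc
    rw [h]
    simp only [dr]
    rw [map_add, map_smul, map_smul]
    rfl
  have hgX : M.g (i p) X X = c 0 ^ 2 + c 1 ^ 2 := hg
  have hs0 : dr (i p) X = 0 := by
    have h0 : dr (i p) (e 0) ^ 2 ≤ 1 / 16 := by
      have := sq_le_sq' (abs_le.1 (hdr 0)).1 (abs_le.1 (hdr 0)).2
      linarith
    have h1 : dr (i p) (e 1) ^ 2 ≤ 1 / 16 := by
      have := sq_le_sq' (abs_le.1 (hdr 1)).1 (abs_le.1 (hdr 1)).2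
      linarith
    have hcs : dr (i p) X ^ 2 ≤ (c 0 ^ 2 + c 1 ^ 2) * (1 / 8) := by
      calc dr (i p) X ^ 2
          ≤ (c 0 ^ 2 + c 1 ^ 2) * (dr (i p) (e 0) ^ 2 + dr (i p) (e 1) ^ 2) := by
            rw [hs]
            nlinarith [sq_nonneg (c 0 * dr (i p) (e 1) - c 1 * dr (i p) (e 0))]
        _ ≤ _ := by gcongr; linarith
    rw [hgX] at hclose
    have hk := mul_le_mul_of_nonneg_right hcoef (sq_nonneg (dr (i p) X))
    have hε' := mul_le_mul_of_nonneg_right hε (sq_nonneg (dr (i p) X))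
    -- With `s = dr(X)²`: `8s ≤ g(X, X) ≤ (1 + 4 + 2)s`, where `2s` bounds the perturbation.
    have : dr (i p) X ^ 2 ≤ 0 := by linarith
    exact pow_eq_zero_iff two_ne_zero |>.1 (this.antisymm (sq_nonneg _))
  have hX0 : X = 0 := by
    rw [hs0, dv_apply] at hv
    rw [dr_apply] at hs0
    exact Prod.ext hv (Prod.ext hs0 hu)
  exact hi.2 p (hX0.trans (map_zero _).symm)

end KerrSlab

/-! ### The embedding criterion. -/

open KerrSlab
/-- Embedding criterion: in a small perturbation of a subextremal Kerr spacetime near the horizon,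
an immersed sphere in `Σ_τ` that is locally embedded and whose tangent planes carry orthonormal
frames with small `e_a(r)` is embedded, and is a graph `r = R(ω)` over the sphere. -/
theorem proposition3p2 (m a : ℝ) (ha : |a| < m) :
    ∃ δ₀ : ℝ, 0 < δ₀ ∧ ∃ δ₁ : ℝ, 0 < δ₁ ∧ ∀ δ : ℝ, 0 < δ → δ ≤ δ₀ →
      ∃ ε₀ : ℝ, 0 < ε₀ ∧ ∀ ε : ℝ, 0 ≤ ε → ε ≤ ε₀ →
        ∀ (M : PerturbedKerr m a δ ε) (τ : ℝ), 0 ≤ τ →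
          ∀ i : S2 → M4, IsImmersionMap i →
            (∀ p, i p ∈ slice m a δ τ ∩ nearHorizon m a δ) →
            (∀ p : S2, ∃ O : Set S2, IsOpen O ∧ p ∈ O ∧ Topology.IsEmbedding (O.domRestrict i) ∧
              ∃ e : Fin 2 → (x : M4) → TangentSpace I4 x,
                IsTangentOrthonormalFrame M.g i O e ∧
                  ∀ b, ∀ x ∈ i '' O, |dr x (e b x)| ≤ δ₁) →
            IsEmbeddingMap i ∧
              ∃ R : S2 → ℝ, ContMDiff (𝓡 2) 𝓘(ℝ, ℝ) ∞ R ∧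
                (∀ p, R p ∈ Set.Icc (rPlus m a - δ) (rPlus m a + δ)) ∧
                sliceMap τ '' Set.range (fun p : S2 => (R p, p)) = Set.range i := by
  have hm : 0 < m := (abs_nonneg a).trans_lt ha
  -- `δ ≤ m / 4` and `r₊ ≥ m` keep `r ≥ m / 2`; the values `1 / 4` and `1` yield the comparison of 8
  -- with 7 in `eq_zero_of_vertical`.
  refine ⟨m / 4, by positivity, 1 / 4, by norm_num, fun δ _ hδ => ⟨1, one_pos, ?_⟩⟩
  intro ε _ hε M τ hτ i hi hslice hframe
  have : Fact (Module.finrank ℝ (EuclideanSpace ℝ (Fin 3)) = 2 + 1) := ⟨by simp⟩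
  let f : S2 → S2 := fun p => (i p).2.2
  have hf : ContMDiff (𝓡 2) (𝓡 2) ∞ f := (contMDiff_snd.comp contMDiff_snd).comp hi.1
  have hmf : ∀ p (u : EuclideanSpace ℝ (Fin 2)),
      mfderiv (𝓡 2) (𝓡 2) f p u = (mfderiv (𝓡 2) I4 i p u : E4).2.2 := fun p u => by
    have h := (hasMFDerivAt_snd_snd (i p)).comp p
      (hi.1.mdifferentiableAt (by simp) (x := p)).hasMFDerivAt
    have h' : mfderiv (𝓡 2) (𝓡 2) f p = _ := h.mfderiv
    rw [h']
    rfl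
  have hf' : ∀ p, ∃ f' : EuclideanSpace ℝ (Fin 2) ≃L[ℝ] EuclideanSpace ℝ (Fin 2),
      ∀ u : EuclideanSpace ℝ (Fin 2), mfderiv (𝓡 2) (𝓡 2) f p u = f' u := fun p => by
    obtain ⟨O, -, hp, -, e, he, hdr⟩ := hframe p
    let L : EuclideanSpace ℝ (Fin 2) →ₗ[ℝ] EuclideanSpace ℝ (Fin 2) :=
      (mfderiv (𝓡 2) (𝓡 2) f p).toLinearMap
    have hL : Function.Injective L := (injective_iff_map_eq_zero L).2 fun u hu =>
      eq_zero_of_vertical ha hδ hε M hτ hi hslice (he p hp).1 (he p hp).2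
        (fun b => hdr b (i p) ⟨p, hp, rfl⟩) u ((hmf p u).symm.trans hu)
    exact ⟨(LinearEquiv.ofInjectiveEndo L hL).toContinuousLinearEquiv, fun u => rfl⟩
  have hne : (∞ : ℕ∞ω) ≠ 0 := by simp
  have hbij : Function.Bijective f := (hf.isLocalHomeomorph hne hf').bijective_sphere one_lt_two
  have hinj : Function.Injective i := fun p q h => hbij.1 (congrArg (fun x : M4 => x.2.2) h)
  refine ⟨⟨hi, (hi.1.continuous.isClosedEmbedding hinj).isEmbedding⟩, ?_⟩
  obtain ⟨f₁, hleft, hright⟩ := Function.bijective_iff_has_inverse.1 hbij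
  have hf₁ : ContMDiff (𝓡 2) (𝓡 2) ∞ f₁ := hf.contMDiff_inverse hne hf' hleft hright
  have hgraph : ∀ q, sliceMap τ (rCoord (i (f₁ q)), q) = i (f₁ q) := fun q => by
    have h1 : vCoord (i (f₁ q)) - rCoord (i (f₁ q)) = τ := (hslice (f₁ q)).1.1
    refine Prod.ext ?_ (Prod.ext rfl (hright q).symm)
    change τ + rCoord (i (f₁ q)) = vCoord (i (f₁ q))
    linarith
  refine ⟨fun q => rCoord (i (f₁ q)), ?_, fun q => ?_, ?_⟩
  · exact (contMDiff_fst.comp contMDiff_snd).comp (hi.1.comp hf₁)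
  · have h : |rCoord (i (f₁ q)) - rPlus m a| ≤ δ := (hslice (f₁ q)).2
    rw [abs_le] at h
    constructor <;> linarith
  · rw [← Set.range_comp]
    have : sliceMap τ ∘ (fun q : S2 => (rCoord (i (f₁ q)), q)) = i ∘ f₁ := funext hgraph
    rw [this, (Function.RightInverse.surjective hleft).range_comp]
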